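/- Let $\tau=\{0,1,+,\cdot,<\}$ be the vocabulary of ordered semirings, and let $\mathrm{PA}$ be the $\tau$-theory consisting of the axioms of discretely ordered semirings (with least element $0$) and the first-order induction scheme. Fix an increasing sequence of sub-vocabularies $\tau_0\subseteq\tau_1\subseteq\cdots$ with $\bigcup_k\tau_k=\tau$ (for instance $\tau_k=\tau$ for all $k$, or $\tau_k$ the set of the first $k$ symbols of $\tau$). For $\tau$-structures $\mathcal A,\mathcal B$, finite tuples $\bar a\in A^{<\omega}$, $\bar b\in B^{<\omega}$ and ordinals $\alpha$ define the back-and-forth relations $\leq_\alpha$ by recursion: $(\mathcal A,\bar a)\leq_0(\mathcal B,\bar b)$ if $|\bar a|\leq|\bar b|$ and $\bar a$ and $\bar b\restriction|\bar a|$ satisfy the same quantifier-free $\tau_{|\bar a|}$-formulas; and for $\alpha>0$, \[(\mathcal A,\bar a)\leq_\alpha(\mathcal B,\bar b)\iff\forall\beta<\alpha\ \forall\bar d\in B^{<\omega}\ \exists\bar c\in A^{<\omega}\ \ (\mathcal B,\bar b\bar d)\leq_\beta(\mathcal A,\bar a\bar c).\] Lemma. Let $\mathcal M$ be a model of $\mathrm{PA}$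 and let $\bar a,\bar b\in M^{<\omega}$ be tuples of the same length. Then $(\mathcal M,\bar a)\leq_\omega(\mathcal M,\bar b)$ if and only if $\mathrm{tp}(\bar a)=\mathrm{tp}(\bar b)$, where $\mathrm{tp}(\bar a)$ is the complete first-order type of $\bar a$ in $\mathcal M$ (without parameters), i.e. the set of $\tau$-formulas $\varphi(\bar x)$ with $\mathcal M\models\varphi(\bar a)$. -/

import Mathlib

open FirstOrder FirstOrder.Language
open scoped Ordinal

universe u v w

namespace PABackForth

/-! ### The vocabulary and the theory of Peano arithmetic -/

/-- The function symbols `0, 1, +, ·`. -/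
inductive ArithFunc : ℕ → Type
  | zero : ArithFunc 0
  | one : ArithFunc 0
  | add : ArithFunc 2
  | mul : ArithFunc 2

/-- The relation symbol `<`. -/
inductive ArithRel : ℕ → Type
  | lt : ArithRel 2

/-- The vocabulary `{0, 1, +, ·, <}` of ordered semirings. -/
def arith : FirstOrder.Language.{0, 0} where
  Functions := ArithFunc
  Relations := ArithRel

instance {α : Type u} : Zero (arith.Term α) where
  zero := Constants.term (L := arith) ArithFunc.zero

instance {α : Type u} : One (arith.Term α) where
  one := Constants.term (L := arith) ArithFunc.one

instance {α : Type u} : Add (arith.Term α) where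
  add := Functions.apply₂ (L := arith) ArithFunc.add

instance {α : Type u} : Mul (arith.Term α) where
  mul := Functions.apply₂ (L := arith) ArithFunc.mul

/-- The variable `x_i` in a formula in the variables `x_0, ..., x_{n-1}`. -/
def X (n : ℕ) (i : Fin n) : arith.Term (Empty ⊕ Fin n) :=
  Term.var (Sum.inr i)

/-- The atomic formula `s < t`. -/
def ltF {α : Type u} {n : ℕ} (s t : arith.Term (α ⊕ Fin n)) : arith.BoundedFormula α n :=
  Relations.boundedFormula₂ (L := arith) ArithRel.lt s t

/-- The axioms of discretely ordered semirings (with least element `0`), each one the universal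
closure of a formula in the variables `X n 0, ..., X n (n - 1)`. -/
inductive IsSemiringAxiom : arith.Sentence → Prop
  | add_assoc : IsSemiringAxiom
      (((X 3 0 + X 3 1) + X 3 2) =' (X 3 0 + (X 3 1 + X 3 2)) : arith.BoundedFormula Empty 3).alls
  | add_comm : IsSemiringAxiom
      ((X 2 0 + X 2 1) =' (X 2 1 + X 2 0) : arith.BoundedFormula Empty 2).alls
  | mul_assoc : IsSemiringAxiom
      (((X 3 0 * X 3 1) * X 3 2) =' (X 3 0 * (X 3 1 * X 3 2)) : arith.BoundedFormula Empty 3).alls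
  | mul_comm : IsSemiringAxiom
      ((X 2 0 * X 2 1) =' (X 2 1 * X 2 0) : arith.BoundedFormula Empty 2).alls
  | mul_add : IsSemiringAxiom
      ((X 3 0 * (X 3 1 + X 3 2)) =' (X 3 0 * X 3 1 + X 3 0 * X 3 2) :
        arith.BoundedFormula Empty 3).alls
  | add_zero : IsSemiringAxiom
      ((X 1 0 + 0) =' X 1 0 : arith.BoundedFormula Empty 1).alls
  | mul_zero : IsSemiringAxiom
      ((X 1 0 * 0) =' 0 : arith.BoundedFormula Empty 1).alls
  | mul_one : IsSemiringAxiom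
      ((X 1 0 * 1) =' X 1 0 : arith.BoundedFormula Empty 1).alls
  | lt_trans : IsSemiringAxiom
      ((ltF (X 3 0) (X 3 1) ⊓ ltF (X 3 1) (X 3 2)) ⟹ ltF (X 3 0) (X 3 2) :
        arith.BoundedFormula Empty 3).alls
  | lt_irrefl : IsSemiringAxiom
      (∼(ltF (X 1 0) (X 1 0)) : arith.BoundedFormula Empty 1).alls
  | lt_trichotomy : IsSemiringAxiom
      (ltF (X 2 0) (X 2 1) ⊔ (X 2 0 =' X 2 1) ⊔ ltF (X 2 1) (X 2 0) :
        arith.BoundedFormula Empty 2).alls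
  | add_lt_add : IsSemiringAxiom
      (ltF (X 3 0) (X 3 1) ⟹ ltF (X 3 0 + X 3 2) (X 3 1 + X 3 2) :
        arith.BoundedFormula Empty 3).alls
  | mul_lt_mul : IsSemiringAxiom
      ((ltF 0 (X 3 2) ⊓ ltF (X 3 0) (X 3 1)) ⟹ ltF (X 3 0 * X 3 2) (X 3 1 * X 3 2) :
        arith.BoundedFormula Empty 3).alls
  | exists_add : IsSemiringAxiom
      (ltF (X 2 0) (X 2 1) ⟹ (((X 3 0 + X 3 2) =' X 3 1 : arith.BoundedFormula Empty 3).ex) :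
        arith.BoundedFormula Empty 2).alls
  | zero_lt_one : IsSemiringAxiom
      (ltF 0 1 : arith.BoundedFormula Empty 0).alls
  | discrete : IsSemiringAxiom
      (ltF 0 (X 1 0) ⟹ (ltF 1 (X 1 0) ⊔ (1 =' X 1 0)) : arith.BoundedFormula Empty 1).alls
  | zero_le : IsSemiringAxiom
      (ltF 0 (X 1 0) ⊔ (0 =' X 1 0) : arith.BoundedFormula Empty 1).alls

/-- Universal quantification of the last variable `x = Sum.inr ()`. -/
noncomputable def forallLast {n : ℕ} (φ : arith.Formula (Fin n ⊕ Unit)) : arith.Formula (Fin n) :=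
  φ.iAlls Unit

/-- The induction axiom for `φ(ȳ, x)`, with parameter variables `ȳ = Sum.inl i` and induction
variable `x = Sum.inr ()`: the universal closure of
`φ(ȳ, 0) ∧ ∀ x (φ(ȳ, x) → φ(ȳ, x + 1)) → ∀ x φ(ȳ, x)`. -/
noncomputable def inductionAxiom {n : ℕ} (φ : arith.Formula (Fin n ⊕ Unit)) : arith.Sentence :=
  Formula.iAlls (α := Empty) (Fin n) <| Formula.relabel Sum.inr <|
    (BoundedFormula.subst φ (Sum.elim Term.var fun _ => (0 : arith.Term (Fin n))) ⊓
      forallLast (φ.imp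
        (BoundedFormula.subst φ
          (Sum.elim (fun i => Term.var (Sum.inl i))
            fun _ => (Term.var (Sum.inr ()) + 1 : arith.Term (Fin n ⊕ Unit)))))).imp
    (forallLast φ)

/-- Peano arithmetic: discretely ordered semirings with the full first-order induction scheme. -/
def PA : arith.Theory :=
  {σ | IsSemiringAxiom σ} ∪ {σ | ∃ (n : ℕ) (φ : arith.Formula (Fin n ⊕ Unit)), σ = inductionAxiom φ}

/-! ### Back-and-forth relations -/

section

variable {L : FirstOrder.Language.{v, w}}

/-- The sub-vocabulary consisting of the symbols in `S`. -/
def subvocabulary (S : Set L.Symbols) : FirstOrder.Language.{v, w} where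
  Functions n := {f : L.Functions n // Sum.inl ⟨n, f⟩ ∈ S}
  Relations n := {r : L.Relations n // Sum.inr ⟨n, r⟩ ∈ S}

/-- The inclusion of a sub-vocabulary. -/
def inclusion (S : Set L.Symbols) : subvocabulary S →ᴸ L where
  onFunction _ f := f.1
  onRelation _ r := r.1

/-- Tuples `a ∈ A ^ k`, `b ∈ B ^ k` satisfy the same quantifier-free `S`-formulas. -/
def SameQF (S : Set L.Symbols) {A B : Type u} [L.Structure A] [L.Structure B] {k : ℕ}
    (a : Fin k → A) (b : Fin k → B) : Prop :=
  ∀ φ : (subvocabulary S).Formula (Fin k), φ.IsQF →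
    (((inclusion S).onFormula φ).Realize a ↔ ((inclusion S).onFormula φ).Realize b)

/-- The asymmetric back-and-forth relation `(A, a) ≤_α (B, b)` with respect to an approximation
`τ 0 ⊆ τ 1 ⊆ ...` of the vocabulary. For `α = 0` it says that `a` and `b ↾ |a|` satisfy the same
quantifier-free `τ |a|`-formulas. -/
def BackForth (τ : ℕ → Set L.Symbols) (α : Ordinal.{0}) {A B : Type u} [L.Structure A]
    [L.Structure B] {m n : ℕ} (a : Fin m → A) (b : Fin n → B) : Prop :=
  (α = 0 → ∃ h : m ≤ n, SameQF (τ m) a (b ∘ Fin.castLE h)) ∧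
  (α ≠ 0 → ∀ β : Ordinal.{0}, β < α → ∀ (k : ℕ) (d : Fin k → B),
    ∃ (l : ℕ) (c : Fin l → A), BackForth τ β (Fin.append b d) (Fin.append a c))
termination_by α

theorem backForth_zero (τ : ℕ → Set L.Symbols) {A B : Type u} [L.Structure A]
    [L.Structure B] {m n : ℕ} (a : Fin m → A) (b : Fin n → B) :
    BackForth τ 0 a b ↔ ∃ h : m ≤ n, SameQF (τ m) a (b ∘ Fin.castLE h) := by
  rw [BackForth]; simp

theorem backForth_of_ne_zero (τ : ℕ → Set L.Symbols) {α : Ordinal.{0}} (hα : α ≠ 0)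
    {A B : Type u} [L.Structure A] [L.Structure B] {m n : ℕ} (a : Fin m → A) (b : Fin n → B) :
    BackForth τ α a b ↔ ∀ β < α, ∀ (k : ℕ) (d : Fin k → B),
      ∃ (l : ℕ) (c : Fin l → A), BackForth τ β (Fin.append b d) (Fin.append a c) := by
  rw [BackForth]; simp [hα]

end

end PABackForth

/-! From `≤_ω` to types: by induction on a formula, a sufficiently high finite level of the relation
makes tuples matched position by position agree on it (`BackForth.exists_realize_iff`). Two points
need care. Level `0` sees only part of the vocabulary; since the vocabulary is finite, padding a
move with dummy elements makes all of it visible. Responses may have any length;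
`BackForth.length_le` shows that they are long enough to contain a match for every element played.

From types to `≤_ω`: if every element is standard, then every element is definable, so the tuples
are equal. Otherwise the argument is an overspill that plays the role of saturation. Tuples are
coded by single elements, and `Bisim k x y` says inside the model that a coded partial isomorphism
matches what is generated from `x` and `y` in `k` steps; `Game n k` puts `n` alternating moves in
front of it. For each standard `n`, `Game n k x y` is definable in `k, x, y`.

For standard `k` only finitely many generating functions occur, so `Game n k x y` follows from
agreement of `x` and `y` on finitely many definable predicates (`exists_finite_game`), and hence
from equality of types. Induction cannot let it hold at exactly the standard `k`, so it holds at
some nonstandard `k` (`exists_game_of_nonstandard`). At such a `k` one response works for all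
standard depths at once, so the final position satisfies the same quantifier-free formulas, and the
internal game yields every finite level of the real relation (`Game.backForth`).

The coding is Gödel's: externally finite sets are coded by divisibility by moduli `1 + (z + 1) * N`
(`exists_code`). -/

namespace PABackForth

/-! ### Models of Peano arithmetic as ordered semirings -/

/-- An `arith`-structure which is a canonically ordered discrete semiring satisfying the induction
scheme. -/
class PeanoModel (M : Type u) [arith.Structure M] extends
    CommSemiring M, LinearOrder M, IsStrictOrderedRing M, CanonicallyOrderedAdd M where
  funMap_zero : ∀ v : Fin 0 → M, Structure.funMap (L := arith) ArithFunc.zero v = 0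
  funMap_one : ∀ v : Fin 0 → M, Structure.funMap (L := arith) ArithFunc.one v = 1
  funMap_add : ∀ v : Fin 2 → M, Structure.funMap (L := arith) ArithFunc.add v = v 0 + v 1
  funMap_mul : ∀ v : Fin 2 → M, Structure.funMap (L := arith) ArithFunc.mul v = v 0 * v 1
  relMap_lt : ∀ v : Fin 2 → M, Structure.RelMap (L := arith) ArithRel.lt v ↔ v 0 < v 1
  one_le_of_pos : ∀ x : M, 0 < x → 1 ≤ x
  induction : ∀ {n : ℕ} (φ : arith.Formula (Fin n ⊕ Unit)) (p : Fin n → M),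
    φ.Realize (Sum.elim p fun _ => 0) →
    (∀ x, φ.Realize (Sum.elim p fun _ => x) → φ.Realize (Sum.elim p fun _ => x + 1)) →
    ∀ x, φ.Realize (Sum.elim p fun _ => x)

section OfPA

variable {M : Type u} [arith.Structure M]

theorem realize_zero {α : Type v} (w : α → M) :
    (0 : arith.Term α).realize w = Structure.funMap (L := arith) ArithFunc.zero ![] := by
  refine (Term.realize_constants (L := arith) (c := ArithFunc.zero) (v := w)).trans ?_
  exact congrArg (Structure.funMap _) (Subsingleton.elim _ _)

theorem realize_one {α : Type v} (w : α → M) :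
    (1 : arith.Term α).realize w = Structure.funMap (L := arith) ArithFunc.one ![] := by
  refine (Term.realize_constants (L := arith) (c := ArithFunc.one) (v := w)).trans ?_
  exact congrArg (Structure.funMap _) (Subsingleton.elim _ _)

theorem realize_add {α : Type v} (s t : arith.Term α) (w : α → M) :
    (s + t).realize w =
      Structure.funMap (L := arith) ArithFunc.add ![s.realize w, t.realize w] :=
  Term.realize_functions_apply₂ (L := arith) (f := ArithFunc.add)

theorem realize_mul {α : Type v} (s t : arith.Term α) (w : α → M) :
    (s * t).realize w =
      Structure.funMap (L := arith) ArithFunc.mul ![s.realize w, t.realize w] :=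
  Term.realize_functions_apply₂ (L := arith) (f := ArithFunc.mul)

theorem realize_ltF {α : Type v} {n : ℕ} (s t : arith.Term (α ⊕ Fin n)) (w : α → M)
    (x : Fin n → M) :
    (ltF s t).Realize w x ↔ Structure.RelMap (L := arith) ArithRel.lt
      ![s.realize (Sum.elim w x), t.realize (Sum.elim w x)] :=
  BoundedFormula.realize_rel₂

theorem realize_X {n : ℕ} (i : Fin n) (w : Empty → M) (x : Fin n → M) :
    (X n i).realize (Sum.elim w x) = x i := rfl

theorem realize_of_isSemiringAxiom [M ⊨ PA] {n : ℕ} {φ : arith.BoundedFormula Empty n}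
    (h : IsSemiringAxiom φ.alls) (x : Fin n → M) : φ.Realize (default : Empty → M) x :=
  BoundedFormula.realize_alls.1 (Theory.realize_sentence_of_mem PA (M := M) (Or.inl h)) x

/-- Phrased with raw `Structure.funMap`, because the semiring structure on `M` is not yet available
here. -/
theorem induction_of_models_PA [M ⊨ PA] {n : ℕ} (φ : arith.Formula (Fin n ⊕ Unit)) (p : Fin n → M)
    (h0 : φ.Realize (Sum.elim p fun _ => Structure.funMap (L := arith) ArithFunc.zero ![]))
    (h1 : ∀ x, φ.Realize (Sum.elim p fun _ => x) →
      φ.Realize (Sum.elim p fun _ => Structure.funMap (L := arith) ArithFunc.add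
        ![x, Structure.funMap (L := arith) ArithFunc.one ![] ])) (x : M) :
    φ.Realize (Sum.elim p fun _ => x) := by
  have h := Theory.realize_sentence_of_mem PA (M := M) (Or.inr ⟨n, φ, rfl⟩)
  rw [inductionAxiom, Sentence.Realize, Formula.realize_iAlls] at h
  replace h := h p
  rw [Formula.realize_relabel] at h
  have hp : (fun a => Sum.elim (default : Empty → M) p a) ∘ Sum.inr = p := rfl
  rw [hp, Formula.realize_imp, Formula.realize_inf, forallLast, forallLast, Formula.realize_iAlls,
    Formula.realize_iAlls] at h
  refine h ⟨?_, fun y => ?_⟩ fun _ => x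
  · refine BoundedFormula.realize_subst.2 ?_
    refine (iff_of_eq (congrArg (fun v => BoundedFormula.Realize φ v default) ?_)).1 h0
    funext i
    rcases i with i | i
    · rfl
    · simp [realize_zero]
  · rw [Formula.realize_imp]
    intro hy
    refine BoundedFormula.realize_subst.2 ?_
    refine (iff_of_eq (congrArg (fun v => BoundedFormula.Realize φ v default) ?_)).1 (h1 (y ()) hy)
    funext i
    rcases i with i | i
    · rfl
    · simp [realize_add, realize_one]

/-- A model of `PA` as an ordered semiring. -/
@[reducible]
noncomputable def peanoModelOfPA (M : Type u) [arith.Structure M] [M ⊨ PA] : PeanoModel M := by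
  classical
  let z : M := Structure.funMap (L := arith) ArithFunc.zero ![]
  let o : M := Structure.funMap (L := arith) ArithFunc.one ![]
  let ad : M → M → M := fun x y => Structure.funMap (L := arith) ArithFunc.add ![x, y]
  let mu : M → M → M := fun x y => Structure.funMap (L := arith) ArithFunc.mul ![x, y]
  let lt : M → M → Prop := fun x y => Structure.RelMap (L := arith) ArithRel.lt ![x, y]
  have add_assoc (x y w : M) : ad (ad x y) w = ad x (ad y w) := by
    simpa [realize_add, realize_X] using realize_of_isSemiringAxiom .add_assoc ![x, y, w]
  have add_comm (x y : M) : ad x y = ad y x := by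
    simpa [realize_add, realize_X] using realize_of_isSemiringAxiom .add_comm ![x, y]
  have mul_assoc (x y w : M) : mu (mu x y) w = mu x (mu y w) := by
    simpa [realize_mul, realize_X] using realize_of_isSemiringAxiom .mul_assoc ![x, y, w]
  have mul_comm (x y : M) : mu x y = mu y x := by
    simpa [realize_mul, realize_X] using realize_of_isSemiringAxiom .mul_comm ![x, y]
  have mul_add (x y w : M) : mu x (ad y w) = ad (mu x y) (mu x w) := by
    simpa [realize_mul, realize_add, realize_X] using
      realize_of_isSemiringAxiom .mul_add ![x, y, w]
  have add_zero (x : M) : ad x z = x := by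
    simpa [realize_add, realize_zero, realize_X] using realize_of_isSemiringAxiom .add_zero ![x]
  have mul_zero (x : M) : mu x z = z := by
    simpa [realize_mul, realize_zero, realize_X] using realize_of_isSemiringAxiom .mul_zero ![x]
  have mul_one (x : M) : mu x o = x := by
    simpa [realize_mul, realize_one, realize_X] using realize_of_isSemiringAxiom .mul_one ![x]
  have lt_trans (x y w : M) : lt x y → lt y w → lt x w := by
    simpa [realize_ltF, realize_X] using realize_of_isSemiringAxiom .lt_trans ![x, y, w]
  have lt_irrefl (x : M) : ¬ lt x x := by
    simpa [realize_ltF, realize_X] using realize_of_isSemiringAxiom .lt_irrefl ![x]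
  have lt_trichotomy (x y : M) : (lt x y ∨ x = y) ∨ lt y x := by
    simpa [realize_ltF, realize_X] using realize_of_isSemiringAxiom .lt_trichotomy ![x, y]
  have add_lt_add (x y w : M) : lt x y → lt (ad x w) (ad y w) := by
    simpa [realize_ltF, realize_add, realize_X] using
      realize_of_isSemiringAxiom .add_lt_add ![x, y, w]
  have mul_lt_mul (x y w : M) : lt z w → lt x y → lt (mu x w) (mu y w) := by
    simpa [realize_ltF, realize_mul, realize_zero, realize_X] using
      realize_of_isSemiringAxiom .mul_lt_mul ![x, y, w]
  have exists_add (x y : M) : lt x y → ∃ w, ad x w = y := by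
    simpa [realize_ltF, realize_add, realize_X, Fin.snoc] using
      realize_of_isSemiringAxiom .exists_add ![x, y]
  have zero_lt_one : lt z o := by
    simpa [realize_ltF, realize_one, realize_zero] using
      realize_of_isSemiringAxiom (M := M) .zero_lt_one ![]
  have discrete (x : M) : lt z x → lt o x ∨ o = x := by
    simpa [realize_ltF, realize_one, realize_zero, realize_X] using
      realize_of_isSemiringAxiom .discrete ![x]
  have zero_le (x : M) : lt z x ∨ z = x := by
    simpa [realize_ltF, realize_zero, realize_X] using
      realize_of_isSemiringAxiom .zero_le ![x]
  have le_antisymm (x y : M) (h : lt x y ∨ x = y) (h' : lt y x ∨ y = x) : x = y := by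
    rcases h with h | h
    · rcases h' with h' | h'
      · exact (lt_irrefl _ (lt_trans _ _ _ h h')).elim
      · exact h'.symm
    · exact h
  have le_add (x y : M) : lt x (ad x y) ∨ x = ad x y := by
    rcases zero_le y with h | h
    · left
      have := add_lt_add z y x h
      rwa [add_comm z, add_zero, add_comm y] at this
    · right
      rw [← h, add_zero]
  letI : CommSemiring M :=
    { add := ad
      mul := mu
      zero := z
      one := o
      add_assoc := add_assoc
      add_comm := add_comm
      zero_add := fun x => (add_comm z x).trans (add_zero x)
      add_zero := add_zero
      nsmul := @nsmulRec M ⟨z⟩ ⟨ad⟩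
      left_distrib := mul_add
      right_distrib := fun x y w => by
        change mu (ad x y) w = ad (mu x w) (mu y w)
        rw [mul_comm, mul_add, mul_comm w x, mul_comm w y]
      zero_mul := fun x => (mul_comm z x).trans (mul_zero x)
      mul_zero := mul_zero
      mul_assoc := mul_assoc
      one_mul := fun x => (mul_comm o x).trans (mul_one x)
      mul_one := mul_one
      mul_comm := mul_comm }
  letI : LinearOrder M :=
    { le := fun x y => lt x y ∨ x = y
      lt := lt
      le_refl := fun x => Or.inr rfl
      le_trans := by
        rintro x y w (h | rfl) (h' | rfl)
        · exact Or.inl (lt_trans _ _ _ h h')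
        · exact Or.inl h
        · exact Or.inl h'
        · exact Or.inr rfl
      lt_iff_le_not_ge := by
        intro x y
        refine ⟨fun h => ⟨Or.inl h, ?_⟩, fun h => h.1.resolve_right fun e => h.2 (Or.inr e.symm)⟩
        rintro (h' | rfl)
        · exact lt_irrefl _ (lt_trans _ _ _ h h')
        · exact lt_irrefl _ h
      le_antisymm := le_antisymm
      le_total := by
        intro x y
        rcases lt_trichotomy x y with (h | h) | h
        · exact Or.inl (Or.inl h)
        · exact Or.inl (Or.inr h)
        · exact Or.inr (Or.inl h)
      toDecidableLE := Classical.decRel _ }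
  have add_le_add (x y : M) (h : x ≤ y) (w : M) : w + x ≤ w + y := by
    rcases h with h | rfl
    · left
      have := add_lt_add x y w h
      rwa [add_comm x, add_comm y] at this
    · exact le_rfl
  have le_of_add (x y w : M) (h : x + y ≤ x + w) : y ≤ w := by
    by_contra hn
    have := add_lt_add w y x (not_le.1 hn)
    rw [add_comm w, add_comm y] at this
    exact absurd h (not_le.2 this)
  letI : IsStrictOrderedRing M :=
    { add_le_add_left := fun x y h w => by
        change ad x w ≤ ad y w
        rw [add_comm x, add_comm y]; exact add_le_add x y h w
      le_of_add_le_add_left := le_of_add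
      zero_le_one := Or.inl zero_lt_one
      exists_pair_ne := ⟨z, o, fun h => lt_irrefl z (by have := zero_lt_one; rwa [← h] at this)⟩
      mul_lt_mul_of_pos_left := fun w hw x y h => by
        change lt (mu w x) (mu w y)
        rw [mul_comm w, mul_comm w]
        exact mul_lt_mul x y w hw h
      mul_lt_mul_of_pos_right := fun w hw x y h => mul_lt_mul x y w hw h }
  letI : CanonicallyOrderedAdd M :=
    { exists_add_of_le := by
        rintro x y (h | rfl)
        · obtain ⟨w, hw⟩ := exists_add x y h
          exact ⟨w, hw.symm⟩
        · exact ⟨z, (add_zero x).symm⟩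
      le_add_self := fun x y => by
        change lt x (ad y x) ∨ x = ad y x
        rw [add_comm y]; exact le_add x y
      le_self_add := le_add }
  exact
    { funMap_zero := fun v => congrArg _ (Subsingleton.elim v ![])
      funMap_one := fun v => congrArg _ (Subsingleton.elim v ![])
      funMap_add := fun v => congrArg _ (List.ofFn_inj.1 (by simp) : v = ![v 0, v 1])
      funMap_mul := fun v => congrArg _ (List.ofFn_inj.1 (by simp) : v = ![v 0, v 1])
      relMap_lt := fun v => by
        have h : v = ![v 0, v 1] := List.ofFn_inj.1 (by simp)
        conv_lhs => rw [h]
        rfl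
      one_le_of_pos := discrete
      induction := fun φ p h0 h1 => induction_of_models_PA φ p h0 h1 }

end OfPA

/-! ### Back-and-forth equivalence implies equality of types -/

section Vocabulary

variable {L : FirstOrder.Language.{v, w}} {A B : Type u} [L.Structure A] [L.Structure B]

theorem SameQF.realize_iff {S : Set L.Symbols} (hS : S = Set.univ) {k : ℕ} {a : Fin k → A}
    {b : Fin k → B} (h : SameQF S a b) {φ : L.Formula (Fin k)} (hφ : φ.IsAtomic) :
    φ.Realize a ↔ φ.Realize b := by
  subst hS
  let F : L →ᴸ subvocabulary (L := L) Set.univ :=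
    { onFunction := fun _ f => ⟨f, trivial⟩
      onRelation := fun _ r => ⟨r, trivial⟩ }
  have hF : (inclusion (L := L) Set.univ).comp F = LHom.id L := rfl
  have hFφ : (inclusion (L := L) Set.univ).onFormula (F.onFormula φ) = φ := by
    have := congrFun (LHom.comp_onBoundedFormula (α := Fin k) (n := 0)
      (inclusion (L := L) Set.univ) F) φ
    rw [hF, LHom.id_onBoundedFormula] at this
    exact this.symm
  have hq : (F.onFormula φ).IsQF := by
    cases hφ with
    | equal t₁ t₂ => exact (BoundedFormula.IsAtomic.equal _ _).isQF
    | rel R ts => exact (BoundedFormula.IsAtomic.rel _ _).isQF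
  have := h _ hq
  rwa [hFφ] at this

theorem eventually_eq_univ [Finite L.Symbols] {τ : ℕ → Set L.Symbols} (hτ : Monotone τ)
    (hτ' : ⋃ k, τ k = Set.univ) : ∃ N, ∀ m, N ≤ m → τ m = Set.univ := by
  have h (s : L.Symbols) : ∃ k, s ∈ τ k := Set.mem_iUnion.1 (hτ' ▸ Set.mem_univ s)
  choose k hk using h
  obtain ⟨N, hN⟩ := (Set.finite_range k).bddAbove
  exact ⟨N, fun m hm => Set.eq_univ_of_forall fun s =>
    hτ ((hN ⟨s, rfl⟩).trans hm) (hk s)⟩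

end Vocabulary

instance : Finite arith.Symbols := by
  have hf : Finite (Σ l, ArithFunc l) := by
    refine Finite.of_surjective (α := Fin 4)
      ![⟨0, .zero⟩, ⟨0, .one⟩, ⟨2, .add⟩, ⟨2, .mul⟩] ?_
    rintro ⟨_, _ | _ | _ | _⟩
    · exact ⟨0, rfl⟩
    · exact ⟨1, rfl⟩
    · exact ⟨2, rfl⟩
    · exact ⟨3, rfl⟩
  have hr : Finite (Σ l, ArithRel l) := by
    refine Finite.of_surjective (α := Unit) (fun _ => ⟨2, .lt⟩) ?_
    rintro ⟨_, ⟨⟩⟩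
    exact ⟨(), rfl⟩
  exact inferInstanceAs (Finite ((Σ l, ArithFunc l) ⊕ (Σ l, ArithRel l)))

/-- `x` and `y` occur at the same position of the tuples `a` and `b`. -/
def Linked {A B : Type u} {p q : ℕ} (a : Fin p → A) (b : Fin q → B) (x : A) (y : B) : Prop :=
  ∃ (j : ℕ) (h : j < p) (h' : j < q), a ⟨j, h⟩ = x ∧ b ⟨j, h'⟩ = y

section Linked

variable {A B : Type u} {p q : ℕ} {a : Fin p → A} {b : Fin q → B}

theorem append_mk_of_lt {k : ℕ} (d : Fin k → A) {j : ℕ} (h : j < p) (h' : j < p + k) :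
    Fin.append a d ⟨j, h'⟩ = a ⟨j, h⟩ :=
  Fin.append_left a d ⟨j, h⟩

theorem append_mk_add {k : ℕ} (d : Fin k → A) {j : ℕ} (h : j < k) (h' : p + j < p + k) :
    Fin.append a d ⟨p + j, h'⟩ = d ⟨j, h⟩ :=
  Fin.append_right a d ⟨j, h⟩

theorem Linked.append {x : A} {y : B} (h : Linked a b x y) {k l : ℕ} (d : Fin k → B)
    (c : Fin l → A) : Linked (Fin.append b d) (Fin.append a c) y x := by
  obtain ⟨j, hj, hj', hx, hy⟩ := h
  exact ⟨j, by omega, by omega, (append_mk_of_lt d hj' _).trans hy,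
    (append_mk_of_lt c hj _).trans hx⟩

theorem linked_snoc {k : ℕ} {xs : Fin k → A} {ys : Fin k → B} {x : A} {y : B}
    (h : ∀ i, Linked a b (xs i) (ys i)) (hxy : Linked a b x y) (i : Fin (k + 1)) :
    Linked a b (Fin.snoc (α := fun _ => A) xs x i) (Fin.snoc (α := fun _ => B) ys y i) := by
  induction i using Fin.lastCases with
  | last => simpa using hxy
  | cast i => simpa using h i

end Linked

section

variable {M : Type u} [arith.Structure M] {τ : ℕ → Set arith.Symbols}

/-- A nonzero level leaves one move; spending it on `N` dummy elements makes the tuple long enough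
for level `0` to see the whole vocabulary. -/
theorem BackForth.atomic_iff {L : FirstOrder.Language.{v, w}} {M : Type u} [L.Structure M]
    [Nonempty M] {τ : ℕ → Set L.Symbols} {N : ℕ}
    (hN : ∀ m, N ≤ m → τ m = Set.univ) {p q : ℕ} {a : Fin p → M} {b : Fin q → M} {α : Ordinal.{0}}
    (hα : α ≠ 0) (h : BackForth τ α a b) {γ : Type*} {v w : γ → M}
    (hvw : ∀ i, Linked a b (v i) (w i)) :
    (∀ t₁ t₂ : L.Term γ, t₁.realize v = t₂.realize v ↔ t₁.realize w = t₂.realize w) ∧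
    (∀ (l : ℕ) (R : L.Relations l) (ts : Fin l → L.Term γ),
      Structure.RelMap R (fun i => (ts i).realize v) ↔
        Structure.RelMap R (fun i => (ts i).realize w)) := by
  let e : M := Classical.arbitrary M
  obtain ⟨l, c, hc⟩ := (backForth_of_ne_zero τ hα a b).1 h 0 (pos_iff_ne_zero.2 hα) N fun _ => e
  obtain ⟨hle, hqf⟩ := (backForth_zero τ _ _).1 hc
  have hf (i : γ) : ∃ j : Fin (q + N), Fin.append b (fun _ => e) j = w i ∧
      (Fin.append a c ∘ Fin.castLE hle) j = v i := by
    obtain ⟨j, hj, hj', hx, hy⟩ := (hvw i).append (fun _ : Fin N => e) c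
    exact ⟨⟨j, hj⟩, hx, hy⟩
  choose f hfw hfv using hf
  have hw : Fin.append b (fun _ => e) ∘ f = w := funext hfw
  have hv : (Fin.append a c ∘ Fin.castLE hle) ∘ f = v := funext hfv
  have hu := hN (q + N) (Nat.le_add_left _ _)
  constructor
  · intro t₁ t₂
    have := hqf.realize_iff hu (φ := (t₁.relabel f).equal (t₂.relabel f)) (.equal _ _)
    rw [Formula.realize_equal, Formula.realize_equal] at this
    simp only [Term.realize_relabel, hw, hv] at this
    exact this.symm
  · intro l R ts
    have := hqf.realize_iff hu (φ := R.formula fun i => (ts i).relabel f) (.rel _ _)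
    rw [Formula.realize_rel, Formula.realize_rel] at this
    simp only [Term.realize_relabel, hw, hv] at this
    exact this.symm

theorem BackForth.length_le [PeanoModel M] {N : ℕ} (hN : ∀ m, N ≤ m → τ m = Set.univ) {p q : ℕ}
    {a : Fin p → M} {b : Fin q → M} {α : Ordinal.{0}} (h : BackForth τ α a b) : p ≤ q := by
  by_cases hα : α = 0
  · subst hα
    exact ((backForth_zero τ _ _).1 h).1
  by_contra hpq
  rw [not_le] at hpq
  -- If `a` were longer, its entry at position `q` would face the first element played after `b`;
  -- `e` is chosen to differ from that entry on the atomic formula `x = 0`.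
  obtain ⟨e, he⟩ : ∃ e : M, e = 0 ↔ a ⟨q, hpq⟩ ≠ 0 := by
    by_cases h0 : a ⟨q, hpq⟩ = 0
    · exact ⟨1, by simp [h0]⟩
    · exact ⟨0, by simp [h0]⟩
  obtain ⟨l, c, hc⟩ :=
    (backForth_of_ne_zero τ hα a b).1 h 0 (pos_iff_ne_zero.2 hα) (N + 1) fun _ => e
  obtain ⟨hle, hqf⟩ := (backForth_zero τ _ _).1 hc
  have := hqf.realize_iff (hN _ (by omega))
    (φ := (Term.var ⟨q + 0, by omega⟩ : arith.Term _).equal 0) (.equal _ _)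
  rw [Formula.realize_equal, Formula.realize_equal, realize_zero, realize_zero,
    PeanoModel.funMap_zero, Term.realize_var, Term.realize_var,
    append_mk_add _ (Nat.succ_pos N)] at this
  have ha : (Fin.append a c ∘ Fin.castLE hle) ⟨q + 0, by omega⟩ = a ⟨q, hpq⟩ :=
    append_mk_of_lt c hpq _
  rw [ha, he] at this
  exact not_iff_self this

theorem BackForth.exists_realize_iff [PeanoModel M] {N : ℕ} (hN : ∀ m, N ≤ m → τ m = Set.univ)
    {γ : Type*} {k : ℕ} (φ : arith.BoundedFormula γ k) :
    ∃ r : ℕ, ∀ s : ℕ, r < s → ∀ {p q : ℕ} {a : Fin p → M} {b : Fin q → M},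
      BackForth τ s a b → ∀ {v w : γ → M} {xs ys : Fin k → M},
      (∀ i, Linked a b (v i) (w i)) → (∀ i, Linked a b (xs i) (ys i)) →
      (φ.Realize v xs ↔ φ.Realize w ys) := by
  induction φ with
  | falsum => exact ⟨0, fun _ _ _ _ _ _ _ _ _ _ _ _ _ => Iff.rfl⟩
  | equal t₁ t₂ =>
    refine ⟨0, fun s hs p q a b h v w xs ys hv hx => ?_⟩
    exact (h.atomic_iff hN (by exact_mod_cast hs.ne') (v := Sum.elim v xs) (w := Sum.elim w ys)
      (Sum.rec hv hx)).1 t₁ t₂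
  | rel R ts =>
    refine ⟨0, fun s hs p q a b h v w xs ys hv hx => ?_⟩
    exact (h.atomic_iff hN (by exact_mod_cast hs.ne') (v := Sum.elim v xs) (w := Sum.elim w ys)
      (Sum.rec hv hx)).2 _ R ts
  | imp φ ψ ihφ ihψ =>
    obtain ⟨r₁, h₁⟩ := ihφ
    obtain ⟨r₂, h₂⟩ := ihψ
    refine ⟨max r₁ r₂, fun s hs p q a b h v w xs ys hv hx => ?_⟩
    rw [BoundedFormula.realize_imp, BoundedFormula.realize_imp,
      h₁ s ((le_max_left _ _).trans_lt hs) h hv hx, h₂ s ((le_max_right _ _).trans_lt hs) h hv hx]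
  | all φ ih =>
    obtain ⟨r, hr⟩ := ih
    -- A move on the `b` side refutes only one implication, so this costs one level. The converse
    -- first makes an empty move to exchange the sides, which costs a second one.
    have key {s p q : ℕ} (hs : r + 1 < s) {a : Fin p → M} {b : Fin q → M} (h : BackForth τ s a b)
        {v w : _ → M} {xs ys : Fin _ → M} (hv : ∀ i, Linked a b (v i) (w i))
        (hx : ∀ i, Linked a b (xs i) (ys i)) (hφ : φ.all.Realize v xs) : φ.all.Realize w ys := by
      intro y
      obtain ⟨l, c, hc⟩ := (backForth_of_ne_zero τ (by exact_mod_cast (by omega : s ≠ 0)) a b).1 h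
        (r + 1 : ℕ) (by exact_mod_cast hs) 1 fun _ => y
      have hlen := hc.length_le hN
      refine (hr (r + 1) r.lt_succ_self hc (fun i => (hv i).append _ _) (linked_snoc
        (fun i => (hx i).append _ _) ?_)).2 (hφ (Fin.append a c ⟨q, hlen⟩))
      exact ⟨q + 0, by omega, by omega, append_mk_add _ zero_lt_one _, rfl⟩
    refine ⟨r + 2, fun s hs p q a b h v w xs ys hv hx => ⟨key (by omega) h hv hx, ?_⟩⟩
    obtain ⟨l, c, hc⟩ := (backForth_of_ne_zero τ (by exact_mod_cast (by omega : s ≠ 0)) a b).1 h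
      (r + 2 : ℕ) (by exact_mod_cast hs) 0 Fin.elim0
    exact key (by omega) hc (fun i => (hv i).append _ _) (fun i => (hx i).append _ _)

end

/-! ### Definable predicates and functions -/

section Definability

variable {M : Type u} [arith.Structure M] {α β : Type}

/-- The predicate `P` of assignments is defined by a formula without parameters. -/
def DefPred (P : (α → M) → Prop) : Prop :=
  ∃ φ : arith.Formula α, ∀ v, φ.Realize v ↔ P v

/-- The function `f` of assignments has a definable graph. -/
def DefFun (f : (α → M) → M) : Prop :=
  DefPred fun v : α ⊕ Unit → M => v (Sum.inr ()) = f (v ∘ Sum.inl)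

namespace DefPred

variable {P Q : (α → M) → Prop}

theorem congr (hP : DefPred P) (h : ∀ v, P v ↔ Q v) : DefPred Q :=
  hP.imp fun _ hφ v => (hφ v).trans (h v)

theorem comp (hP : DefPred P) (g : α → β) : DefPred fun v : β → M => P (v ∘ g) := by
  obtain ⟨φ, hφ⟩ := hP
  exact ⟨φ.relabel g, fun v => Formula.realize_relabel.trans (hφ _)⟩

theorem not (hP : DefPred P) : DefPred fun v => ¬ P v := by
  obtain ⟨φ, hφ⟩ := hP
  exact ⟨φ.not, fun v => Formula.realize_not.trans (not_congr (hφ v))⟩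

theorem and (hP : DefPred P) (hQ : DefPred Q) : DefPred fun v => P v ∧ Q v := by
  obtain ⟨φ, hφ⟩ := hP
  obtain ⟨ψ, hψ⟩ := hQ
  exact ⟨φ ⊓ ψ, fun v => Formula.realize_inf.trans (and_congr (hφ v) (hψ v))⟩

theorem imp (hP : DefPred P) (hQ : DefPred Q) : DefPred fun v => P v → Q v := by
  obtain ⟨φ, hφ⟩ := hP
  obtain ⟨ψ, hψ⟩ := hQ
  exact ⟨φ.imp ψ, fun v => Formula.realize_imp.trans (imp_congr (hφ v) (hψ v))⟩

theorem or (hP : DefPred P) (hQ : DefPred Q) : DefPred fun v => P v ∨ Q v :=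
  (hP.not.imp hQ).congr fun v => by tauto

theorem iff (hP : DefPred P) (hQ : DefPred Q) : DefPred fun v => (P v ↔ Q v) :=
  ((hP.imp hQ).and (hQ.imp hP)).congr fun v => by tauto

theorem exs [Finite β] {R : (α → M) → (β → M) → Prop}
    (hR : DefPred fun v : α ⊕ β → M => R (v ∘ Sum.inl) (v ∘ Sum.inr)) :
    DefPred fun v => ∃ w, R v w := by
  obtain ⟨φ, hφ⟩ := hR
  exact ⟨φ.iExs β, fun v => Formula.realize_iExs.trans (exists_congr fun w => hφ _)⟩

theorem ex {R : (α → M) → M → Prop}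
    (hR : DefPred fun v : α ⊕ Unit → M => R (v ∘ Sum.inl) (v (Sum.inr ()))) :
    DefPred fun v => ∃ x, R v x :=
  (exs (R := fun v w => R v (w ())) hR).congr fun _ =>
    ⟨fun ⟨w, hw⟩ => ⟨w (), hw⟩, fun ⟨x, hx⟩ => ⟨fun _ => x, hx⟩⟩

theorem all {R : (α → M) → M → Prop}
    (hR : DefPred fun v : α ⊕ Unit → M => R (v ∘ Sum.inl) (v (Sum.inr ()))) :
    DefPred fun v => ∀ x, R v x :=
  (ex (R := fun v x => ¬ R v x) hR.not).not.congr fun v => by simp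

theorem const_true : DefPred fun _ : α → M => True :=
  ⟨⊤, fun _ => by simp⟩

theorem forall_mem_finite {ι : Type*} {s : Set ι} (hs : s.Finite) {R : ι → (α → M) → Prop}
    (hR : ∀ i ∈ s, DefPred (R i)) : DefPred fun v => ∀ i ∈ s, R i v := by
  induction s, hs using Set.Finite.induction_on with
  | empty => exact const_true.congr fun v => by simp
  | @insert i s _ _ ih =>
    exact ((hR i (Set.mem_insert _ _)).and
      (ih fun j hj => hR j (Set.mem_insert_of_mem _ hj))).congr fun v => by simp

/-- Only the graphs of the `f b` are definable, so substitution goes through an existential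
quantifier over their values. -/
theorem comp_fun [Finite β] {P : (β → M) → Prop} (hP : DefPred P) {f : β → (α → M) → M}
    (hf : ∀ b, DefFun (f b)) : DefPred fun v => P fun b => f b v := by
  refine (exs (R := fun v w => (∀ b ∈ Set.univ, w b = f b v) ∧ P w)
    ((forall_mem_finite Set.finite_univ fun b _ =>
      DefPred.comp (β := α ⊕ β) (hf b) (Sum.map id fun _ => b)).and
      (hP.comp Sum.inr))).congr fun v => ⟨?_, fun h => ⟨_, fun _ _ => rfl, h⟩⟩
  rintro ⟨w, hw, h⟩
  rwa [funext fun b => hw b trivial] at h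

theorem comp_fun₂ {R : M → M → Prop} (hR : DefPred fun v : Fin 2 → M => R (v 0) (v 1))
    {f g : (α → M) → M} (hf : DefFun f) (hg : DefFun g) : DefPred fun v => R (f v) (g v) :=
  hR.comp_fun (f := ![f, g]) (Fin.forall_fin_two.2 ⟨hf, hg⟩)

end DefPred

namespace DefFun

variable {f g : (α → M) → M}

theorem comp (hf : DefFun f) (g : α → β) : DefFun fun v : β → M => f (v ∘ g) :=
  DefPred.comp (β := β ⊕ Unit) hf (Sum.map g id)

theorem ofTerm (t : arith.Term α) : DefFun fun v : α → M => t.realize v :=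
  ⟨(Term.var (Sum.inr ())).equal (t.relabel Sum.inl), fun v => by
    rw [Formula.realize_equal, Term.realize_relabel, Term.realize_var]⟩

theorem var (i : α) : DefFun fun v : α → M => v i :=
  ofTerm (Term.var i)

theorem comp_fun [Finite β] {h : (β → M) → M} (hh : DefFun h) {f : β → (α → M) → M}
    (hf : ∀ b, DefFun (f b)) : DefFun fun v => h fun b => f b v :=
  DefPred.comp_fun (β := β ⊕ Unit) hh
    (f := Sum.elim (fun b v => f b (v ∘ Sum.inl)) fun _ v => v (Sum.inr ()))
    (Sum.rec (fun b => (hf b).comp Sum.inl) fun _ => var _)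

theorem comp_fun₁ {h : M → M} (hh : DefFun fun v : Unit → M => h (v ())) (hf : DefFun f) :
    DefFun fun v => h (f v) :=
  hh.comp_fun (f := fun _ => f) fun _ => hf

theorem comp_fun₂ {h : M → M → M} (hh : DefFun fun v : Fin 2 → M => h (v 0) (v 1))
    (hf : DefFun f) (hg : DefFun g) : DefFun fun v => h (f v) (g v) :=
  hh.comp_fun (f := ![f, g]) (Fin.forall_fin_two.2 ⟨hf, hg⟩)

end DefFun

theorem DefPred.eq {f g : (α → M) → M} (hf : DefFun f) (hg : DefFun g) :
    DefPred fun v => f v = g v := by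
  refine DefPred.comp_fun₂ (R := fun x y => x = y) ⟨(Term.var 0).equal (Term.var 1), fun v => ?_⟩
    hf hg
  rw [Formula.realize_equal, Term.realize_var, Term.realize_var]

section Peano

variable [PeanoModel M] {f g : (α → M) → M}

theorem DefFun.zero : DefFun fun _ : α → M => (0 : M) := by
  simpa only [realize_zero, PeanoModel.funMap_zero] using DefFun.ofTerm (M := M) (0 : arith.Term α)

theorem DefFun.one : DefFun fun _ : α → M => (1 : M) := by
  simpa only [realize_one, PeanoModel.funMap_one] using DefFun.ofTerm (M := M) (1 : arith.Term α)

theorem DefFun.add (hf : DefFun f) (hg : DefFun g) : DefFun fun v => f v + g v := by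
  refine DefFun.comp_fun₂ (h := fun x y => x + y) ?_ hf hg
  refine (DefFun.ofTerm (M := M) (Term.var 0 + Term.var 1 : arith.Term (Fin 2))).congr
    fun v => ?_
  beta_reduce
  rw [realize_add, PeanoModel.funMap_add]
  rfl

theorem DefFun.mul (hf : DefFun f) (hg : DefFun g) : DefFun fun v => f v * g v := by
  refine DefFun.comp_fun₂ (h := fun x y => x * y) ?_ hf hg
  refine (DefFun.ofTerm (M := M) (Term.var 0 * Term.var 1 : arith.Term (Fin 2))).congr
    fun v => ?_
  beta_reduce
  rw [realize_mul, PeanoModel.funMap_mul]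
  rfl

theorem DefPred.lt (hf : DefFun f) (hg : DefFun g) : DefPred fun v => f v < g v := by
  refine DefPred.comp_fun₂ (R := fun x y => x < y) ⟨Relations.formula₂ (L := arith) ArithRel.lt
    (Term.var 0) (Term.var 1), fun v => ?_⟩ hf hg
  exact (Formula.realize_rel₂ (L := arith) (R := ArithRel.lt)).trans (PeanoModel.relMap_lt _)

theorem DefPred.dvd (hf : DefFun f) (hg : DefFun g) : DefPred fun v => f v ∣ g v :=
  (DefPred.ex (R := fun v x => g v = f v * x)
    (DefPred.eq (hg.comp Sum.inl) ((hf.comp Sum.inl).mul (DefFun.var _)))).congr fun _ => Iff.rfl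

theorem DefPred.induction {n : ℕ} {R : (Fin n → M) → M → Prop}
    (hR : DefPred fun v : Fin n ⊕ Unit → M => R (v ∘ Sum.inl) (v (Sum.inr ()))) (p : Fin n → M)
    (h0 : R p 0) (h1 : ∀ x, R p x → R p (x + 1)) (x : M) : R p x := by
  obtain ⟨φ, hφ⟩ := hR
  exact (hφ _).1 (PeanoModel.induction φ p ((hφ _).2 h0)
    (fun x hx => (hφ _).2 (h1 x ((hφ _).1 hx))) x)

end Peano

end Definability

/-! ### Pairing and coding of finite sets in models of Peano arithmetic -/

section Coding

variable {M : Type u} [arith.Structure M] [PeanoModel M]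

theorem add_one_le_of_lt {x y : M} (h : x < y) : x + 1 ≤ y := by
  obtain ⟨d, rfl⟩ := exists_add_of_le h.le
  have hd : 0 < d := by
    rw [pos_iff_ne_zero]
    rintro rfl
    simp at h
  gcongr
  exact PeanoModel.one_le_of_pos d hd

/-- The standard numbers form an initial segment, so a nonstandard element exceeds all of them. -/
theorem lt_natCast_iff (x : M) (n : ℕ) : x < n ↔ ∃ m < n, x = (m : M) := by
  induction n with
  | zero => simp
  | succ n ih =>
    constructor
    · intro h
      rcases lt_trichotomy x n with hx | hx | hx
      · obtain ⟨m, hm, rfl⟩ := ih.1 hx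
        exact ⟨m, by omega, rfl⟩
      · exact ⟨n, by omega, hx⟩
      · have := add_one_le_of_lt hx
        push_cast at h
        exact absurd h (not_lt.2 this)
    · rintro ⟨m, hm, rfl⟩
      exact_mod_cast hm

/-- The Cantor-style pairing function `(x + y)² + x`. -/
def pair (x y : M) : M := (x + y) * (x + y) + x

/-- With `s = x + y`, the pair lies in the interval from `s²` to `(s + 1)²`, the upper end excluded.
-/
theorem pair_lt_pair {x y x' y' : M} (h : x + y < x' + y') : pair x y < pair x' y' := by
  have h1 := add_one_le_of_lt h
  calc pair x y < (x + y + 1) * (x + y + 1) := by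
        have : (x + y + 1) * (x + y + 1) = pair x y + (x + y + y + 1) := by
          rw [pair]; ring
        rw [this]
        exact lt_add_of_pos_right _ (add_pos_of_nonneg_of_pos zero_le one_pos)
    _ ≤ (x' + y') * (x' + y') := mul_le_mul' h1 h1
    _ ≤ pair x' y' := le_self_add

theorem pair_injective {x y x' y' : M} (h : pair x y = pair x' y') : x = x' ∧ y = y' := by
  have hs : x + y = x' + y' := by
    rcases lt_trichotomy (x + y) (x' + y') with hs | hs | hs
    · exact absurd h (pair_lt_pair hs).ne
    · exact hs
    · exact absurd h (pair_lt_pair hs).ne'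
  have hx : x = x' := by
    rw [pair, pair, hs] at h
    exact add_left_cancel h
  subst hx
  exact ⟨rfl, add_left_cancel hs⟩

open Classical in
/-- The first component of a pair, and `0` for elements which are not pairs. -/
noncomputable def fst (z : M) : M := if h : ∃ x y, z = pair x y then h.choose else 0

open Classical in
/-- The second component of a pair, and `0` for elements which are not pairs. -/
noncomputable def snd (z : M) : M := if h : ∃ y x, z = pair x y then h.choose else 0

@[simp]
theorem fst_pair (x y : M) : fst (pair x y) = x := by
  have h : ∃ x' y', pair x y = pair x' y' := ⟨x, y, rfl⟩
  rw [fst, dif_pos h]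
  obtain ⟨y', hy⟩ := h.choose_spec
  exact (pair_injective hy).1.symm

@[simp]
theorem snd_pair (x y : M) : snd (pair x y) = y := by
  have h : ∃ y' x', pair x y = pair x' y' := ⟨y, x, rfl⟩
  rw [snd, dif_pos h]
  obtain ⟨x', hx⟩ := h.choose_spec
  exact (pair_injective hx).2.symm

/-- A first-order description of the graph, from which definability of `fst` is read off. -/
theorem eq_fst_iff (w z : M) :
    w = fst z ↔ (∃ y, z = pair w y) ∨ ((¬ ∃ x y, z = pair x y) ∧ w = 0) := by
  by_cases h : ∃ x y, z = pair x y
  · obtain ⟨x, y, rfl⟩ := h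
    rw [fst_pair]
    constructor
    · rintro rfl
      exact Or.inl ⟨y, rfl⟩
    · rintro (⟨y', hy⟩ | ⟨hn, -⟩)
      · exact (pair_injective hy).1.symm
      · exact (hn ⟨x, y, rfl⟩).elim
  · rw [fst, dif_neg h]
    exact ⟨fun hw => Or.inr ⟨h, hw⟩, fun hw => hw.elim (fun hy => (h ⟨w, hy⟩).elim) And.right⟩

theorem eq_snd_iff (w z : M) :
    w = snd z ↔ (∃ x, z = pair x w) ∨ ((¬ ∃ y x, z = pair x y) ∧ w = 0) := by
  by_cases h : ∃ y x, z = pair x y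
  · obtain ⟨y, x, rfl⟩ := h
    rw [snd_pair]
    constructor
    · rintro rfl
      exact Or.inl ⟨x, rfl⟩
    · rintro (⟨x', hx⟩ | ⟨hn, -⟩)
      · exact (pair_injective hx).2.symm
      · exact (hn ⟨y, x, rfl⟩).elim
  · rw [snd, dif_neg h]
    exact ⟨fun hw => Or.inr ⟨h, hw⟩, fun hw => hw.elim (fun hx => (h ⟨w, hx⟩).elim) And.right⟩

section

variable {α : Type} {f g : (α → M) → M}

theorem DefFun.pair (hf : DefFun f) (hg : DefFun g) : DefFun fun v => pair (f v) (g v) :=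
  ((hf.add hg).mul (hf.add hg)).add hf

theorem DefFun.fst (hf : DefFun f) : DefFun fun v => fst (f v) := by
  refine DefFun.comp_fun₁ (h := PABackForth.fst) ?_ hf
  refine DefPred.congr (P := fun v : Unit ⊕ Unit → M =>
    (∃ y, v (Sum.inl ()) = PABackForth.pair (v (Sum.inr ())) y) ∨
      ((¬ ∃ x y, v (Sum.inl ()) = PABackForth.pair x y) ∧ v (Sum.inr ()) = 0)) ?_
      fun v => (eq_fst_iff _ _).symm
  refine (DefPred.ex ?_).or ((DefPred.ex (DefPred.ex ?_)).not.and ?_)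
  · exact .eq (.var (Sum.inl (Sum.inl ()))) (.pair (.var _) (.var _))
  · exact .eq (.var (Sum.inl (Sum.inl (Sum.inl ())))) (.pair (.var (Sum.inl (Sum.inr ()))) (.var _))
  · exact .eq (.var _) .zero

theorem DefFun.snd (hf : DefFun f) : DefFun fun v => snd (f v) := by
  refine DefFun.comp_fun₁ (h := PABackForth.snd) ?_ hf
  refine DefPred.congr (P := fun v : Unit ⊕ Unit → M =>
    (∃ x, v (Sum.inl ()) = PABackForth.pair x (v (Sum.inr ()))) ∨
      ((¬ ∃ y x, v (Sum.inl ()) = PABackForth.pair x y) ∧ v (Sum.inr ()) = 0)) ?_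
      fun v => (eq_snd_iff _ _).symm
  refine (DefPred.ex ?_).or ((DefPred.ex (DefPred.ex ?_)).not.and ?_)
  · exact .eq (.var (Sum.inl (Sum.inl ()))) (.pair (.var _) (.var _))
  · exact .eq (.var (Sum.inl (Sum.inl (Sum.inl ())))) (.pair (.var _) (.var (Sum.inl (Sum.inr ()))))
  · exact .eq (.var _) .zero

end

/-! ### Gödel coding of finite sets by divisibility -/

theorem dvd_of_dvd_add_left {q x y : M} (h : q ∣ x + y) (hx : q ∣ x) : q ∣ y := by
  obtain ⟨s, rfl⟩ := hx
  obtain ⟨t, ht⟩ := h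
  rcases le_total s t with hst | hst
  · obtain ⟨d, rfl⟩ := exists_add_of_le hst
    rw [mul_add] at ht
    exact ⟨d, add_left_cancel ht⟩
  · have hy : q * s + y ≤ q * s + 0 := by
      rw [ht, add_zero]
      exact mul_le_mul_right hst q
    have : y = 0 := le_antisymm (le_of_add_le_add_left hy) zero_le
    simp [this]

/-- A substitute for the factorial of a possibly nonstandard `k`, obtained by induction inside the
model. The bound is written `¬ k < j` so that definability follows from `DefPred.lt`. -/
theorem exists_common_multiple (k : M) : ∃ N : M, 0 < N ∧ ∀ j, 0 < j → ¬ k < j → j ∣ N := by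
  refine DefPred.induction (n := 0)
    (R := fun _ k => ∃ N : M, 0 < N ∧ ∀ j, 0 < j → ¬ k < j → j ∣ N) ?_ ![] ?_ ?_ k
  · refine .ex (.and (.lt .zero (.var _)) (.all (.imp (.lt .zero (.var _)) (.imp (.not ?_) ?_))))
    · exact .lt (.var (Sum.inl (Sum.inl (Sum.inr ())))) (.var _)
    · exact .dvd (.var _) (.var (Sum.inl (Sum.inr ())))
  · exact ⟨1, one_pos, fun j hj hj' => (hj' hj).elim⟩
  · rintro k ⟨N, hN, h⟩
    refine ⟨N * (k + 1), mul_pos hN (add_pos_of_nonneg_of_pos zero_le one_pos),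
      fun j hj hj' => ?_⟩
    by_cases hk : k < j
    · have : j = k + 1 := le_antisymm (not_lt.1 hj') (add_one_le_of_lt hk)
      exact this ▸ dvd_mul_left _ _
    · exact (h j hj hk).mul_right _

/-- The element `z` belongs to the finite set coded by `c`, `N` and `K`. -/
def CodeMem (c N K z : M) : Prop := z < K ∧ 1 + (z + 1) * N ∣ c

/-- Modulo `q` the element `t * N` acts as `-1`, so it can be cancelled; since `e ∣ N`, a multiple
of `e * N * c` is `(t * N)² * c`. -/
theorem dvd_of_dvd_mul {N q t e c : M} (hq : q = 1 + t * N) (he : e ∣ N) (h : q ∣ e * N * c) :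
    q ∣ c := by
  obtain ⟨m, hm⟩ := he
  have h1 : q ∣ (t * N) * ((t * N) * c) := by
    have : (t * N) * ((t * N) * c) = (e * N * c) * (m * t * t) := by
      calc (t * N) * ((t * N) * c) = N * (N * c * t * t) := by ring
        _ = e * m * (N * c * t * t) := by rw [← hm]
        _ = _ := by ring
    rw [this]
    exact h.mul_right _
  have cancel (x : M) (hx : q ∣ (t * N) * x) : q ∣ x := by
    refine dvd_of_dvd_add_left (x := (t * N) * x) ?_ hx
    exact ⟨x, by rw [hq]; ring⟩
  exact cancel _ (cancel _ h1)

/-- The two moduli differ by `e * N`, where `e` is the distance of `z` and `a`. As `e` is at most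
`K` it divides `N`, and `dvd_of_dvd_mul` applies. This replaces coprimality. -/
theorem dvd_of_dvd_modulus_mul {K N z a c : M} (hN : ∀ j, 0 < j → ¬ K < j → j ∣ N) (hz : z < K)
    (ha : a < K) (hne : z ≠ a) (h : 1 + (z + 1) * N ∣ (1 + (a + 1) * N) * c) :
    1 + (z + 1) * N ∣ c := by
  rcases lt_or_gt_of_ne hne with hlt | hlt
  · obtain ⟨e, rfl⟩ := exists_add_of_le hlt.le
    have he : 0 < e := by
      rw [pos_iff_ne_zero]
      rintro rfl
      simp at hlt
    refine dvd_of_dvd_mul rfl (hN e he (not_lt.2 (le_add_self.trans ha.le))) ?_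
    refine dvd_of_dvd_add_left (x := (1 + (z + 1) * N) * c) ?_ (dvd_mul_right _ _)
    convert h using 1
    ring
  · obtain ⟨e, rfl⟩ := exists_add_of_le hlt.le
    have he : 0 < e := by
      rw [pos_iff_ne_zero]
      rintro rfl
      simp at hlt
    refine dvd_of_dvd_mul rfl (hN e he (not_lt.2 (le_add_self.trans hz.le))) ?_
    refine dvd_of_dvd_add_left (x := (1 + (a + 1) * N) * c) ?_ h
    exact ⟨c, by ring⟩

/-- The code is the product of the moduli of the elements. `A` is finite externally, so the
induction over the factors is an external one; `0 < N` keeps a modulus from dividing the empty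
product. -/
theorem exists_code (A : Finset M) : ∃ c N K : M, ∀ z, CodeMem c N K z ↔ z ∈ A := by
  obtain ⟨B, hB⟩ := A.exists_le
  have hK (a : M) (ha : a ∈ A) : a < B + 1 := (hB a ha).trans_lt (lt_add_one B)
  obtain ⟨N, hN, h⟩ := exists_common_multiple (B + 1)
  refine ⟨∏ a ∈ A, (1 + (a + 1) * N), N, B + 1, fun z => ⟨?_, fun hz => ⟨hK z hz, ?_⟩⟩⟩
  · rintro ⟨hz, hdvd⟩
    by_contra hzA
    have key (S : Finset M) (hS : S ⊆ A) : ¬ 1 + (z + 1) * N ∣ ∏ a ∈ S, (1 + (a + 1) * N) := by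
      classical
      induction S using Finset.induction_on with
      | empty =>
        rw [Finset.prod_empty]
        intro h1
        have h2 : 1 + (z + 1) * N ≤ 1 := by
          obtain ⟨m, hm⟩ := h1
          have hm0 : 0 < m := by
            rw [pos_iff_ne_zero]
            rintro rfl
            simp at hm
          calc 1 + (z + 1) * N = (1 + (z + 1) * N) * 1 := (mul_one _).symm
            _ ≤ (1 + (z + 1) * N) * m := mul_le_mul_right (PeanoModel.one_le_of_pos m hm0) _
            _ = 1 := hm.symm
        exact absurd h2 (not_le.2 (lt_add_of_pos_right _
          (mul_pos (add_pos_of_nonneg_of_pos zero_le one_pos) hN)))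
      | insert a S haS ih =>
        rw [Finset.prod_insert haS]
        intro h1
        have haA := hS (Finset.mem_insert_self a S)
        refine ih ((Finset.subset_insert a S).trans hS)
          (dvd_of_dvd_modulus_mul h hz (hK a haA) ?_ h1)
        rintro rfl
        exact hzA haA
    exact key A subset_rfl hdvd
  · exact Finset.dvd_prod_of_mem _ hz

end Coding

/-! ### Internal back-and-forth games -/

section Game

variable {M : Type u} [arith.Structure M] [PeanoModel M]

/-- The functions obtained from the identity by at most `k` successive applications of the
semiring operations and the projections of the pairing function. -/
def termFuns (M : Type u) [arith.Structure M] [PeanoModel M] : ℕ → Set (M → M)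
  | 0 => {id}
  | k + 1 => termFuns M k ∪ {0, 1} ∪ (fst ∘ ·) '' termFuns M k ∪ (snd ∘ ·) '' termFuns M k ∪
      Set.image2 (· + ·) (termFuns M k) (termFuns M k) ∪
      Set.image2 (· * ·) (termFuns M k) (termFuns M k)

theorem finite_termFuns (k : ℕ) : (termFuns M k).Finite := by
  induction k with
  | zero => exact Set.finite_singleton _
  | succ k ih =>
    exact ((((ih.union (Set.toFinite {0, 1})).union (ih.image _)).union (ih.image _)).union
      (ih.image2 _ ih)).union (ih.image2 _ ih)

section

variable {k : ℕ} {s t : M → M}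

theorem mem_termFuns_succ (ht : t ∈ termFuns M k) : t ∈ termFuns M (k + 1) := by
  simp [termFuns, ht]

theorem zero_mem_termFuns : (0 : M → M) ∈ termFuns M (k + 1) := by
  simp [termFuns]

theorem one_mem_termFuns : (1 : M → M) ∈ termFuns M (k + 1) := by
  simp [termFuns]

theorem fst_comp_mem_termFuns (ht : t ∈ termFuns M k) : fst ∘ t ∈ termFuns M (k + 1) :=
  Or.inl (Or.inl (Or.inl (Or.inr ⟨t, ht, rfl⟩)))

theorem snd_comp_mem_termFuns (ht : t ∈ termFuns M k) : snd ∘ t ∈ termFuns M (k + 1) :=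
  Or.inl (Or.inl (Or.inr ⟨t, ht, rfl⟩))

theorem add_mem_termFuns (hs : s ∈ termFuns M k) (ht : t ∈ termFuns M k) :
    s + t ∈ termFuns M (k + 1) :=
  Or.inl (Or.inr ⟨s, hs, t, ht, rfl⟩)

theorem mul_mem_termFuns (hs : s ∈ termFuns M k) (ht : t ∈ termFuns M k) :
    s * t ∈ termFuns M (k + 1) :=
  Or.inr ⟨s, hs, t, ht, rfl⟩

theorem termFuns_succ_cases {P : (M → M) → Prop} (hP : ∀ s ∈ termFuns M k, P s) (h0 : P 0)
    (h1 : P 1) (hfst : ∀ s ∈ termFuns M k, P (fst ∘ s)) (hsnd : ∀ s ∈ termFuns M k, P (snd ∘ s))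
    (hadd : ∀ s ∈ termFuns M k, ∀ t ∈ termFuns M k, P (s + t))
    (hmul : ∀ s ∈ termFuns M k, ∀ t ∈ termFuns M k, P (s * t)) (ht : t ∈ termFuns M (k + 1)) :
    P t := by
  rcases ht with ((((ht | rfl | rfl) | ⟨s, hs, rfl⟩) | ⟨s, hs, rfl⟩) | ⟨s, hs, t, ht, rfl⟩) |
    ⟨s, hs, t, ht, rfl⟩
  · exact hP t ht
  · exact h0
  · exact h1
  · exact hfst s hs
  · exact hsnd s hs
  · exact hadd s hs t ht
  · exact hmul s hs t ht

theorem termFuns_mono : Monotone (termFuns M) :=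
  monotone_nat_of_le_succ fun _ _ => mem_termFuns_succ

theorem comp_mem_termFuns {l : ℕ} (hs : s ∈ termFuns M l) (ht : t ∈ termFuns M k) :
    t ∘ s ∈ termFuns M (l + k) := by
  induction k generalizing t with
  | zero =>
    obtain rfl : t = id := ht
    exact hs
  | succ k ih =>
    refine termFuns_succ_cases (P := fun t => t ∘ s ∈ termFuns M (l + (k + 1))) ?_ ?_ ?_ ?_ ?_ ?_ ?_
      ht
    · exact fun t ht => mem_termFuns_succ (ih ht)
    · exact zero_mem_termFuns
    · exact one_mem_termFuns
    · exact fun t ht => fst_comp_mem_termFuns (ih ht)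
    · exact fun t ht => snd_comp_mem_termFuns (ih ht)
    · exact fun t ht t' ht' => add_mem_termFuns (ih ht) (ih ht')
    · exact fun t ht t' ht' => mul_mem_termFuns (ih ht) (ih ht')

theorem defFun_of_mem_termFuns (ht : t ∈ termFuns M k) : DefFun fun v : Unit → M => t (v ()) := by
  induction k generalizing t with
  | zero =>
    obtain rfl : t = id := ht
    exact .var ()
  | succ k ih =>
    refine termFuns_succ_cases (P := fun t => DefFun fun v : Unit → M => t (v ())) ?_ ?_ ?_ ?_ ?_
      ?_ ?_ ht
    · exact fun t ht => ih ht
    · exact .zero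
    · exact .one
    · exact fun t ht => .fst (ih ht)
    · exact fun t ht => .snd (ih ht)
    · exact fun t ht t' ht' => .add (ih ht) (ih ht')
    · exact fun t ht t' ht' => .mul (ih ht) (ih ht')

end

/-! ### Coded partial isomorphisms, finite games and overspill -/

/-- The relations `r i`, `i ≤ k`, preserve the order, and those pairs which arise by one operation
from pairs in `r i` belong to `r (i + 1)`. -/
def ClosedBelow (r : M → M → M → Prop) (k : M) : Prop :=
  ∀ i u v, i < k → r i u v →
    r (i + 1) u v ∧ r (i + 1) 0 0 ∧ r (i + 1) 1 1 ∧
    r (i + 1) (fst u) (fst v) ∧ r (i + 1) (snd u) (snd v) ∧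
    ∀ u' v', r i u' v' →
      r (i + 1) (u + u') (v + v') ∧ r (i + 1) (u * u') (v * v') ∧ (u < u' ↔ v < v')

/-- A coded partial isomorphism of depth `k` takes `x` to `y`. -/
def Bisim (k x y : M) : Prop :=
  ∃ c N K : M, CodeMem c N K (pair 0 (pair x y)) ∧
    ClosedBelow (fun i u v => CodeMem c N K (pair i (pair u v))) k

theorem DefPred.codeMem {α : Type} {f₁ f₂ f₃ f₄ : (α → M) → M} (h₁ : DefFun f₁) (h₂ : DefFun f₂)
    (h₃ : DefFun f₃) (h₄ : DefFun f₄) : DefPred fun v => CodeMem (f₁ v) (f₂ v) (f₃ v) (f₄ v) :=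
  (DefPred.lt h₄ h₃).and (.dvd (.add .one (.mul (.add h₄ .one) h₂)) h₁)

theorem DefPred.bisim {α : Type} {f g h : (α → M) → M} (hf : DefFun f) (hg : DefFun g)
    (hh : DefFun h) : DefPred fun v => Bisim (f v) (g v) (h v) := by
  have key : DefPred fun v : Fin 3 → M => Bisim (v 0) (v 1) (v 2) := by
    refine .ex <| .ex <| .ex <| .and ?_ ?_
    · apply_rules [DefPred.codeMem, DefFun.pair, DefFun.zero, DefFun.var]
    · refine .all <| .all <| .all <| .imp ?_ <| .imp ?_ <| .and ?_ <| .and ?_ <| .and ?_ <|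
        .and ?_ <| .and ?_ <| .all <| .all <| .imp ?_ <| .and ?_ <| .and ?_ <| .iff ?_ ?_
      all_goals apply_rules [DefPred.codeMem, DefPred.lt, DefFun.pair, DefFun.fst, DefFun.snd,
        DefFun.add, DefFun.mul, DefFun.zero, DefFun.one, DefFun.var]
  exact key.comp_fun (f := ![f, g, h]) (by simp [Fin.forall_fin_succ, hf, hg, hh])

/-- For standard `k` the pairs `(t x, t y)` with `t ∈ termFuns M j`, `j ≤ k`, form a finite set; its
code is the required partial isomorphism. -/
theorem bisim_natCast {k : ℕ} {x y : M}
    (h : ∀ s ∈ termFuns M k, ∀ t ∈ termFuns M k, s x < t x ↔ s y < t y) : Bisim (k : M) x y := by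
  have hfin : (⋃ j ∈ Set.Iic k, (fun t : M → M => pair (j : M) (pair (t x) (t y))) ''
      termFuns M j).Finite :=
    (Set.finite_Iic k).biUnion fun j _ => (finite_termFuns j).image _
  obtain ⟨c, N, K, hc⟩ := exists_code hfin.toFinset
  have hr (i u v : M) : CodeMem c N K (pair i (pair u v)) ↔
      ∃ j ≤ k, ∃ t ∈ termFuns M j, i = (j : M) ∧ u = t x ∧ v = t y := by
    rw [hc]
    simp only [Set.Finite.mem_toFinset, Set.mem_iUnion, Set.mem_Iic, Set.mem_image, exists_prop]
    refine exists_congr fun j => and_congr_right fun _ => exists_congr fun t =>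
      and_congr_right fun _ => ⟨fun he => ?_, ?_⟩
    · obtain ⟨h1, h2⟩ := pair_injective he
      obtain ⟨h2, h3⟩ := pair_injective h2
      exact ⟨h1.symm, h2.symm, h3.symm⟩
    · rintro ⟨rfl, rfl, rfl⟩
      rfl
  refine ⟨c, N, K, (hr _ _ _).2 ⟨0, Nat.zero_le _, id, rfl, by simp⟩, ?_⟩
  intro i u v hi hiuv
  obtain ⟨j, -, t, ht, rfl, rfl, rfl⟩ := (hr _ _ _).1 hiuv
  have hjk : j < k := by exact_mod_cast hi
  have mk {t' : M → M} (ht' : t' ∈ termFuns M (j + 1)) :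
      CodeMem c N K (pair ((j : M) + 1) (pair (t' x) (t' y))) :=
    (hr _ _ _).2 ⟨j + 1, hjk, t', ht', by simp⟩
  refine ⟨mk (mem_termFuns_succ ht), mk zero_mem_termFuns, mk one_mem_termFuns,
    mk (fst_comp_mem_termFuns ht), mk (snd_comp_mem_termFuns ht), fun u' v' huv' => ?_⟩
  obtain ⟨j', -, t', ht', hj, rfl, rfl⟩ := (hr _ _ _).1 huv'
  obtain rfl : j = j' := by exact_mod_cast hj
  exact ⟨mk (add_mem_termFuns ht ht'), mk (mul_mem_termFuns ht ht'),
    h t (termFuns_mono hjk.le ht) t' (termFuns_mono hjk.le ht')⟩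

/-- External induction on `m` puts `(t x, t y)` into layer `m` of the coded relation; a nonstandard
`k` never stops this induction. -/
theorem Bisim.lt_iff {k x y : M} (h : Bisim k x y) (hk : ∀ m : ℕ, (m : M) < k) {m : ℕ}
    {s t : M → M} (hs : s ∈ termFuns M m) (ht : t ∈ termFuns M m) : s x < t x ↔ s y < t y := by
  obtain ⟨c, N, K, h0, hcl⟩ := h
  have key (m : ℕ) {t : M → M} (ht : t ∈ termFuns M m) :
      CodeMem c N K (pair (m : M) (pair (t x) (t y))) := by
    induction m generalizing t with
    | zero =>
      obtain rfl : t = id := ht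
      simpa using h0
    | succ m ih =>
      rw [Nat.cast_succ]
      -- The closure conditions for `0` and `1` apply only once layer `m` contains some pair; the
      -- identity supplies one.
      have hid := ih (termFuns_mono (Nat.zero_le m) (Set.mem_singleton (id : M → M)))
      refine termFuns_succ_cases
        (P := fun t => CodeMem c N K (pair ((m : M) + 1) (pair (t x) (t y)))) ?_ ?_ ?_ ?_ ?_ ?_ ?_
        ht
      · exact fun t ht => (hcl _ _ _ (hk m) (ih ht)).1
      · exact (hcl _ _ _ (hk m) hid).2.1
      · exact (hcl _ _ _ (hk m) hid).2.2.1
      · exact fun t ht => (hcl _ _ _ (hk m) (ih ht)).2.2.2.1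
      · exact fun t ht => (hcl _ _ _ (hk m) (ih ht)).2.2.2.2.1
      · exact fun t ht t' ht' => ((hcl _ _ _ (hk m) (ih ht)).2.2.2.2.2 _ _ (ih ht')).1
      · exact fun t ht t' ht' => ((hcl _ _ _ (hk m) (ih ht)).2.2.2.2.2 _ _ (ih ht')).2.1
  exact ((hcl _ _ _ (hk m) (key m hs)).2.2.2.2.2 _ _ (key m ht)).2.2

/-- The internal back-and-forth relation with `n` rounds, in which tuples are coded by single
elements and the final position is compared up to depth `k`. -/
def Game : ℕ → M → M → M → Prop
  | 0, k, x, y => Bisim k x y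
  | n + 1, k, x, y => Game n k x y ∧ ∀ d, ∃ c, Game n k (pair y d) (pair x c)

theorem Game.bisim {n : ℕ} {k x y : M} (h : Game n k x y) : Bisim k x y := by
  induction n with
  | zero => exact h
  | succ n ih => exact ih h.1

/-- The number of rounds is external and yields one formula for each `n`, while the depth is a
variable of that formula, as overspill requires. -/
theorem DefPred.game {n : ℕ} {α : Type} {f g h : (α → M) → M} (hf : DefFun f) (hg : DefFun g)
    (hh : DefFun h) : DefPred fun v => Game n (f v) (g v) (h v) := by
  induction n generalizing α with
  | zero => exact .bisim hf hg hh
  | succ n ih =>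
    refine .and (ih hf hg hh) <| .all <| .ex <| ih ((hf.comp Sum.inl).comp Sum.inl) ?_ ?_
    · exact .pair ((hh.comp Sum.inl).comp Sum.inl) (.var (Sum.inl (Sum.inr ())))
    · exact .pair ((hg.comp Sum.inl).comp Sum.inl) (.var (Sum.inr ()))

/-- The Hintikka argument: for each `S ⊆ Φ` one new predicate says that some extension satisfies
exactly the members of `S` among `Φ`, which keeps the set finite. -/
theorem exists_finite_game (n k : ℕ) : ∃ Φ : Set (M → Prop), Φ.Finite ∧
    (∀ P ∈ Φ, DefPred fun v : Unit → M => P (v ())) ∧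
    ∀ x y, (∀ P ∈ Φ, P x ↔ P y) → Game n (k : M) x y := by
  induction n with
  | zero =>
    refine ⟨Set.image2 (fun s t x => s x < t x) (termFuns M k) (termFuns M k),
      (finite_termFuns k).image2 _ (finite_termFuns k), ?_, fun x y h => bisim_natCast ?_⟩
    · rintro _ ⟨s, hs, t, ht, rfl⟩
      exact .lt (defFun_of_mem_termFuns hs) (defFun_of_mem_termFuns ht)
    · exact fun s hs t ht => h _ ⟨s, hs, t, ht, rfl⟩
  | succ n ih =>
    obtain ⟨Φ, hfin, hdef, hΦ⟩ := ih
    refine ⟨Φ ∪ (fun S x => ∃ z, ∀ P ∈ Φ, P (pair x z) ↔ P ∈ S) '' 𝒫 Φ,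
      hfin.union (hfin.finite_subsets.image _), ?_, fun x y h => ⟨?_, fun d => ?_⟩⟩
    · rintro _ (hP | ⟨S, -, rfl⟩)
      · exact hdef _ hP
      · refine .ex (.forall_mem_finite hfin fun P hP => .iff ?_ ?_)
        · exact (hdef P hP).comp_fun (f := fun _ v => pair (v (Sum.inl ())) (v (Sum.inr ())))
            fun _ => .pair (.var _) (.var _)
        · by_cases hS : P ∈ S
          · exact DefPred.const_true.congr fun _ => by simp [hS]
          · exact DefPred.const_true.not.congr fun _ => by simp [hS]
    · exact hΦ x y fun P hP => h P (Or.inl hP)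
    · obtain ⟨z, hz⟩ := (h _ (Or.inr ⟨{P ∈ Φ | P (pair y d)}, Set.sep_subset _ _, rfl⟩)).2
        ⟨d, fun P hP => by simp [hP]⟩
      refine ⟨z, hΦ _ _ fun P hP => ?_⟩
      rw [hz P hP]
      simp [hP]

/-- Overspill: otherwise `Game n · x y` would define the standard cut, and induction with parameters
`x, y` would make `k₀` standard. -/
theorem exists_game_of_nonstandard {k₀ : M} (hk₀ : ∀ m : ℕ, k₀ ≠ m) {n : ℕ} {x y : M}
    (h : ∀ m : ℕ, Game n (m : M) x y) : ∃ k, (∀ m : ℕ, (m : M) < k) ∧ Game n k x y := by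
  by_contra hcon
  have hst (k : M) (hk : Game n k x y) : ∃ m : ℕ, k = m := by
    by_contra hm
    push Not at hm
    refine hcon ⟨k, fun m => ?_, hk⟩
    rcases lt_trichotomy (m : M) k with h | h | h
    · exact h
    · exact (hm m h.symm).elim
    · obtain ⟨m', -, rfl⟩ := (lt_natCast_iff k m).1 h
      exact (hm m' rfl).elim
  obtain ⟨m, hm⟩ := hst k₀ <| DefPred.induction (R := fun p k => Game n k (p 0) (p 1))
    (.game (.var _) (.var (Sum.inl 0)) (.var (Sum.inl 1))) ![x, y] (by simpa using h 0)
    (fun k hk => by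
      obtain ⟨m, rfl⟩ := hst k hk
      simpa using h (m + 1)) k₀
  exact hk₀ m hm

/-! ### From the internal game to the relations on tuples -/

theorem exists_encoding (l : ℕ) : ∃ (enc : (Fin l → M) → M) (G : Fin l → M → M) (m : ℕ),
    DefFun enc ∧ (∀ j, G j ∈ termFuns M m) ∧ ∀ d j, G j (enc d) = d j := by
  induction l with
  | zero => exact ⟨fun _ => 0, Fin.elim0, 0, .zero, fun j => j.elim0, fun _ j => j.elim0⟩
  | succ l ih =>
    obtain ⟨enc, G, m, henc, hG, h⟩ := ih
    refine ⟨fun d => pair (d 0) (enc (d ∘ Fin.succ)), Fin.cons fst fun j => G j ∘ snd, 1 + m,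
      .pair (.var 0) (henc.comp Fin.succ), ?_, fun d => ?_⟩
    · refine Fin.cases ?_ fun j => ?_
      · exact termFuns_mono (Nat.le_add_right 1 m)
          (fst_comp_mem_termFuns (Set.mem_singleton (id : M → M)))
      · rw [Fin.cons_succ]
        exact comp_mem_termFuns (snd_comp_mem_termFuns (Set.mem_singleton (id : M → M))) (hG j)
    · refine Fin.cases ?_ fun j => ?_
      · simp
      · simp [h]

theorem exists_termFun_realize {γ : Type*} {F : γ → M → M} {m : ℕ}
    (hF : ∀ i, F i ∈ termFuns M m) (t : arith.Term γ) :
    ∃ m', ∃ s ∈ termFuns M m', ∀ x, t.realize (fun i => F i x) = s x := by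
  induction t with
  | var i => exact ⟨m, F i, hF i, fun x => rfl⟩
  | func f ts ih =>
    choose m' s hs h using ih
    simp only [Term.realize_func, h]
    cases f with
    | zero => exact ⟨1, 0, zero_mem_termFuns, fun x => PeanoModel.funMap_zero _⟩
    | one => exact ⟨1, 1, one_mem_termFuns, fun x => PeanoModel.funMap_one _⟩
    | add =>
      exact ⟨_, s 0 + s 1, add_mem_termFuns (termFuns_mono (le_max_left _ _) (hs 0))
        (termFuns_mono (le_max_right _ _) (hs 1)), fun x => PeanoModel.funMap_add _⟩
    | mul =>
      exact ⟨_, s 0 * s 1, mul_mem_termFuns (termFuns_mono (le_max_left _ _) (hs 0))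
        (termFuns_mono (le_max_right _ _) (hs 1)), fun x => PeanoModel.funMap_mul _⟩

/-- Each term in the entries is a function in some `termFuns M m'`, so `Bisim.lt_iff` settles `<`;
equality is the failure of `<` in both directions. -/
theorem Bisim.sameQF {k x y : M} (h : Bisim k x y) (hk : ∀ m : ℕ, (m : M) < k)
    (S : Set arith.Symbols) {l m : ℕ} {F : Fin l → M → M} (hF : ∀ i, F i ∈ termFuns M m) :
    SameQF S (fun i => F i x) fun i => F i y := by
  let F' : Fin l ⊕ Fin 0 → M → M := Sum.elim F Fin.elim0
  have hF' (i) : F' i ∈ termFuns M m := Sum.rec hF (fun i => i.elim0) i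
  have hval (z : M) : Sum.elim (fun i => F i z) (default : Fin 0 → M) = fun i => F' i z := by
    funext i
    rcases i with i | i
    · rfl
    · exact i.elim0
  have hlt (t₁ t₂ : arith.Term (Fin l ⊕ Fin 0)) :
      t₁.realize (fun i => F' i x) < t₂.realize (fun i => F' i x) ↔
        t₁.realize (fun i => F' i y) < t₂.realize (fun i => F' i y) := by
    obtain ⟨m₁, s₁, hs₁, e₁⟩ := exists_termFun_realize hF' t₁
    obtain ⟨m₂, s₂, hs₂, e₂⟩ := exists_termFun_realize hF' t₂
    rw [e₁, e₁, e₂, e₂]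
    exact h.lt_iff hk (termFuns_mono (le_max_left m₁ m₂) hs₁)
      (termFuns_mono (le_max_right m₁ m₂) hs₂)
  have hrel {j : ℕ} (R : arith.Relations j) (ts : Fin j → arith.Term (Fin l ⊕ Fin 0)) :
      Structure.RelMap R (fun i => (ts i).realize fun i => F' i x) ↔
        Structure.RelMap R (fun i => (ts i).realize fun i => F' i y) := by
    cases R with
    | lt =>
      exact (PeanoModel.relMap_lt fun i => (ts i).realize fun i => F' i x).trans
        ((hlt _ _).trans (PeanoModel.relMap_lt fun i => (ts i).realize fun i => F' i y).symm)
  intro φ hφ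
  induction hφ with
  | falsum => exact Iff.rfl
  | of_isAtomic hφ =>
    cases hφ with
    | equal t₁ t₂ =>
      change ((inclusion S).onTerm t₁).realize (Sum.elim _ default) =
        ((inclusion S).onTerm t₂).realize (Sum.elim _ default) ↔
        ((inclusion S).onTerm t₁).realize (Sum.elim _ default) =
        ((inclusion S).onTerm t₂).realize (Sum.elim _ default)
      rw [hval, hval]
      simp only [le_antisymm_iff, ← not_lt, hlt]
    | rel R ts =>
      have := hrel R.1 fun i => (inclusion S).onTerm (ts i)
      rw [← hval, ← hval] at this
      exact this
  | imp _ _ ih₁ ih₂ => exact imp_congr ih₁ ih₂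

theorem Game.backForth {τ : ℕ → Set arith.Symbols} {n : ℕ} {k x y : M} (h : Game n k x y)
    (hk : ∀ m : ℕ, (m : M) < k) {l m : ℕ} {F : Fin l → M → M} (hF : ∀ i, F i ∈ termFuns M m)
    {α : Ordinal.{0}} (hα : α ≤ n) : BackForth τ α (fun i => F i x) fun i => F i y := by
  induction n generalizing x y l m F α with
  | zero =>
    obtain rfl : α = 0 := by simpa using hα
    exact (backForth_zero τ _ _).2 ⟨le_rfl, h.bisim.sameQF hk _ hF⟩
  | succ n ih =>
    by_cases h0 : α = 0
    · subst h0
      exact (backForth_zero τ _ _).2 ⟨le_rfl, h.bisim.sameQF hk _ hF⟩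
    refine (backForth_of_ne_zero τ h0 _ _).2 fun β hβ j d => ?_
    obtain ⟨enc, G, m', -, hG, hd⟩ := exists_encoding (M := M) j
    -- The response `c` need not be a value of `enc`; the decoding functions `G i` are total, and
    -- only their membership in `termFuns` matters.
    obtain ⟨c, hc⟩ := h.2 (enc d)
    refine ⟨j, fun i => G i c, ?_⟩
    have hβn : β ≤ n := by
      have := hβ.trans_le hα
      rwa [Nat.cast_succ, ← Order.succ_eq_add_one, Order.lt_succ_iff] at this
    have hid : (id : M → M) ∈ termFuns M 0 := Set.mem_singleton _
    -- The new position is again read off one element: old entries through `fst`, new ones through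
    -- `snd`.
    have hH (i : Fin (l + j)) : Fin.append (fun i => F i ∘ fst) (fun i => G i ∘ snd) i ∈
        termFuns M (max (1 + m) (1 + m')) := by
      refine Fin.addCases (fun i => ?_) (fun i => ?_) i
      · rw [Fin.append_left]
        exact termFuns_mono (le_max_left _ _)
          (comp_mem_termFuns (fst_comp_mem_termFuns hid) (hF i))
      · rw [Fin.append_right]
        exact termFuns_mono (le_max_right _ _)
          (comp_mem_termFuns (snd_comp_mem_termFuns hid) (hG i))
    have := ih hc hH hβn
    convert this using 1
    · funext i
      refine Fin.addCases (fun i => ?_) (fun i => ?_) i <;> simp [hd]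
    · funext i
      refine Fin.addCases (fun i => ?_) (fun i => ?_) i <;> simp

theorem BackForth.refl {L : FirstOrder.Language.{v, w}} {A : Type u} [L.Structure A]
    (τ : ℕ → Set L.Symbols) (α : Ordinal.{0}) {l : ℕ} (a : Fin l → A) : BackForth τ α a a := by
  induction α using WellFoundedLT.induction generalizing l with
  | ind α ih =>
    by_cases h0 : α = 0
    · subst h0
      exact (backForth_zero τ _ _).2 ⟨le_rfl, fun _ _ => Iff.rfl⟩
    · exact (backForth_of_ne_zero τ h0 _ _).2 fun β hβ k d => ⟨k, d, ih β hβ _⟩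

theorem DefFun.natCast {α : Type} (n : ℕ) : DefFun fun _ : α → M => (n : M) := by
  induction n with
  | zero => simpa using DefFun.zero
  | succ n ih => simpa using ih.add .one

theorem backForth_omega_of_realize_iff {τ : ℕ → Set arith.Symbols} {l : ℕ} {a b : Fin l → M}
    (h : ∀ φ : arith.Formula (Fin l), φ.Realize a ↔ φ.Realize b) : BackForth τ ω a b := by
  have hdef {P : (Fin l → M) → Prop} (hP : DefPred P) : P a ↔ P b := by
    obtain ⟨φ, hφ⟩ := hP
    rw [← hφ, ← hφ, h]
  by_cases hst : ∀ x : M, ∃ m : ℕ, x = m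
  · obtain rfl : a = b := by
      funext i
      obtain ⟨m, hm⟩ := hst (a i)
      rw [hm, (hdef (.eq (.var i) (.natCast m))).1 hm]
    exact .refl τ ω a
  · push Not at hst
    obtain ⟨k₀, hk₀⟩ := hst
    obtain ⟨enc, G, m, henc, hG, hd⟩ := exists_encoding (M := M) l
    refine (backForth_of_ne_zero τ Ordinal.omega0_ne_zero _ _).2 fun β hβ => ?_
    obtain ⟨n, rfl⟩ := Ordinal.lt_omega0.1 hβ
    -- One round more than `n`: the clause of `≤_ω` for `β = n` is also a clause of `≤_(n + 1)`.
    obtain ⟨k, hk, hgame⟩ := exists_game_of_nonstandard hk₀ (n := n + 1) (x := enc a) (y := enc b)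
      fun j => by
        obtain ⟨Φ, -, hΦ, hgame⟩ := exists_finite_game (M := M) (n + 1) j
        exact hgame _ _ fun P hP => hdef ((hΦ P hP).comp_fun (f := fun _ => enc) fun _ => henc)
    have := hgame.backForth (τ := τ) hk hG le_rfl
    simp only [hd] at this
    exact (backForth_of_ne_zero τ (by simp) _ _).1 this n (by exact_mod_cast n.lt_succ_self)

end Game

end PABackForth

theorem mainTheorem6 {M : Type u} [PABackForth.arith.Structure M] [Nonempty M]
    [M ⊨ PABackForth.PA]
    (τ : ℕ → Set PABackForth.arith.Symbols) (hτ : Monotone τ) (hτ' : ⋃ k, τ k = Set.univ)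
    {n : ℕ} (a b : Fin n → M) :
    PABackForth.BackForth τ ω a b ↔
      PABackForth.PA.typeOf a = PABackForth.PA.typeOf b := by
  let := PABackForth.peanoModelOfPA M
  constructor
  · intro h
    obtain ⟨N, hN⟩ := PABackForth.eventually_eq_univ hτ hτ'
    refine SetLike.ext fun σ => ?_
    obtain ⟨φ, rfl⟩ := Formula.equivSentence.surjective σ
    rw [Theory.CompleteType.formula_mem_typeOf, Theory.CompleteType.formula_mem_typeOf]
    obtain ⟨r, hr⟩ := PABackForth.BackForth.exists_realize_iff (M := M) (τ := τ) hN φ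
    -- An empty move descends to a finite level; it exchanges the two sides, hence the final
    -- `.symm`.
    obtain ⟨l, c, hc⟩ := (PABackForth.backForth_of_ne_zero τ Ordinal.omega0_ne_zero _ _).1 h
      (r + 1 : ℕ) (Ordinal.natCast_lt_omega0 _) 0 Fin.elim0
    have hab (i : Fin n) : PABackForth.Linked a b (a i) (b i) := ⟨i, i.2, i.2, rfl, rfl⟩
    exact (hr (r + 1) r.lt_succ_self hc (fun i => (hab i).append _ _) fun i => i.elim0).symm
  · intro h
    refine PABackForth.backForth_omega_of_realize_iff fun φ => ?_
    rw [← Theory.CompleteType.formula_mem_typeOf (T := PABackForth.PA), h,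
      Theory.CompleteType.formula_mem_typeOf]
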